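/- Let $d\ge 3$ and $\nu>1$. For $\alpha>0$ and $x\in\mathbb{R}^d$ let $W^\alpha_x$ be the law on $C([0,\infty);\mathbb{R}^d)$ of Brownian motion with variance $\alpha$ started at $x$ (that is, of $x+\sqrt{\alpha}\,B$ with $B$ a standard $d$-dimensional Brownian motion). For a set $V\subset\mathbb{R}^d$ let $\tau_V=\inf\{t\ge 0 : X_t\notin V\}$ be the exit time of the canonical path $X$ from $V$. Below, $\alpha$ denotes an arbitrary number in $[\frac{1}{2\nu},2\nu]$; in particular the estimates hold with $\alpha=\alpha_n$, uniformly in $n\ge 0$, for every sequence $(\alpha_n)_{n\ge0}$ with $\frac1{2\nu}\le\alpha_n\le 2\nu$. 1. (Annuli.) For $0<r_1<r_2<\infty$ let $A_{r_1,r_2}=B_{r_2}\setminus\overline{B}_{r_1}$, with the balls centred at the origin. For all $0<r_1<r_2<\infty$ there is $C>0$, depending only on $d,\nu,r_1,r_2$, such that for every $\alpha\in[\frac1{2\nu},2\nu]$ $$E^{W^\alpha_x}(\tau_{A_{r_1,r_2}})\le C\,d(x,\partial B_{r_1})\quad\text{for all }x\in\overline{A}_{r_1,r_2}.$$ Now let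 $U\subset\mathbb{R}^d$ be open and bounded, and let $r_0>0$ be such that for every $x\in\partial U$ there is $x^*\in\mathbb{R}^d$ with $\overline{B}_{r_0}(x^*)\cap\overline{U}=\{x\}$. For a set $V$ and $\delta>0$ write $V_\delta=\{x\in\mathbb{R}^d : d(x,V)<\delta\}$. (Distances to the empty set are $+\infty$.) 2. There is $C>0$, depending only on $d,\nu,U,r_0$, such that for every $\alpha\in[\frac1{2\nu},2\nu]$ and every $0<\delta<\frac{r_0}{2}$ $$\sup_{d(x,\partial U)\le\delta}E^{W^\alpha_x}(\tau_U)\le C\delta\quad\text{and}\quad\sup_{d(x,\partial U_\delta)\le 2\delta}E^{W^\alpha_x}(\tau_{U_\delta})<C\delta.$$ 3. There is $C>0$, depending only on $d,\nu,U,r_0$, such that for every $\alpha\in[\frac1{2\nu},2\nu]$, every $\epsilon>0$ and every $0<\delta<\frac{r_0}{2\epsilon}$ $$\sup_{d(x,\partial (U/\epsilon))\le\delta}E^{W^\alpha_x}(\tau_{U/\epsilon})\le C\epsilon^{-1}\delta\quad\text{and}\quad\sup_{d(x,\partial ((U/\epsilon)_\delta))\le 2\delta}E^{W^\alpha_x}(\tau_{(U/\epsilon)_\delta})<C\epsilon^{-1}\delta.$$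 -/

import Mathlib

open MeasureTheory ProbabilityTheory Metric Set
open scoped NNReal ENNReal Pointwise

/-- The space `C([0,∞); ℝᵈ)` of continuous paths. -/
abbrev PathSpace (d : ℕ) : Type := C(ℝ≥0, EuclideanSpace ℝ (Fin d))

/-- The σ-algebra on path space generated by the canonical process, that is, by the evaluations
`X ↦ X t`. -/
instance PathSpace.instMeasurableSpace (d : ℕ) : MeasurableSpace (PathSpace d) :=
  MeasurableSpace.comap (fun (X : PathSpace d) (t : ℝ≥0) ↦ X t) MeasurableSpace.pi

/-- `W` is the Wiener measure of Brownian motion with variance `α` started at `x`: under `W` the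
canonical process is `X t = x + √α B t` with `B` a standard `d`-dimensional Brownian motion, that is,
the coordinates of `(X - x) / √α` are independent standard real Brownian motions. -/
structure IsWienerMeasure {d : ℕ} (α : ℝ) (x : EuclideanSpace ℝ (Fin d))
    (W : Measure (PathSpace d)) : Prop where
  coord : ∀ i : Fin d, IsBrownianReal (fun t (X : PathSpace d) ↦ (X t i - x i) / √α) W
  indep : iIndepFun (fun (i : Fin d) (X : PathSpace d) (t : ℝ≥0) ↦ (X t i - x i) / √α) W

/-- The exit time `inf {t ≥ 0 | X t ∉ V}` of a path from a set, equal to `∞` if there is no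
such `t`. -/
noncomputable def exitTime {d : ℕ} (V : Set (EuclideanSpace ℝ (Fin d))) (X : PathSpace d) : ℝ≥0∞ :=
  ⨅ (t : ℝ≥0) (_ : X t ∉ V), (t : ℝ≥0∞)

/-- The expectation under `W` of the exit time from `V`. -/
noncomputable def expectedExitTime {d : ℕ} (W : Measure (PathSpace d))
    (V : Set (EuclideanSpace ℝ (Fin d))) : ℝ≥0∞ :=
  ∫⁻ X, exitTime V X ∂W

/-- The open annulus `B_{r₂} \ closure B_{r₁}` centred at the origin. -/
def annulus (d : ℕ) (r₁ r₂ : ℝ) : Set (EuclideanSpace ℝ (Fin d)) :=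
  ball 0 r₂ \ closedBall 0 r₁

/-- The exterior ball condition with radius `r₀`. -/
def ExteriorBallCondition {d : ℕ} (U : Set (EuclideanSpace ℝ (Fin d))) (r₀ : ℝ) : Prop :=
  ∀ x ∈ frontier U, ∃ y : EuclideanSpace ℝ (Fin d), closedBall y r₀ ∩ closure U = {x}

/-!
For `l = d / r₁²` the barrier `u y = 1 - exp (-l |y - c|²)` is strictly superharmonic outside the
ball of radius `r₁` around `c`, and its Gaussian averages can be computed exactly. So along a
Brownian path sampled with a small step until it is first seen outside the annulus
`r₁ ≤ |y - c| ≤ r₂`, the process `κ t + u (X t)` is a supermartingale for some `κ > 0`. Letting the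
mesh tend to zero, Fatou's lemma gives `κ E τ ≤ u x - min u`, and the right-hand side is linear in
the distance from `x` to the inner sphere.

A point `x` within `O(δ)` of the boundary of `U` is close to some boundary point `z`. Shrinking the
exterior ball at `z` by `δ` makes it disjoint from the inflation `U_δ`, which therefore lies in an
annulus whose inner sphere is within `O(δ)` of `x`. The constants are homogeneous under dilations,
so the estimates for `U / ε` hold with the same constant up to the factor `1 / ε`.
-/

section Gaussian

variable {d : ℕ} {l : ℝ} {v : ℝ≥0}

lemma integral_exp_neg_mul_sq_gaussianReal (hl : 0 ≤ l) (y : ℝ) (v : ℝ≥0) :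
    ∫ z, Real.exp (-l * (y + z) ^ 2) ∂gaussianReal 0 v =
      (√(1 + 2 * l * v))⁻¹ * Real.exp (-l * y ^ 2 / (1 + 2 * l * v)) := by
  obtain rfl | hv := eq_or_ne v 0
  · simp
  have hv' : (v : ℝ) ≠ 0 := by exact_mod_cast hv
  set q : ℝ := 1 + 2 * l * v with hq
  have hq0 : 0 < q := by positivity
  have complete_square (z : ℝ) : gaussianPDFReal 0 v z • Real.exp (-l * (y + z) ^ 2) =
      (√(2 * Real.pi * v))⁻¹ * Real.exp (-l * y ^ 2 / q) *
        Real.exp (-(q / (2 * v)) * (z + 2 * l * y * v / q) ^ 2) := by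
    rw [gaussianPDFReal, smul_eq_mul, mul_assoc _⁻¹, mul_assoc _⁻¹, ← Real.exp_add,
      ← Real.exp_add]
    congr 2
    field_simp
    rw [hq]
    ring
  have sqrt_eq : √(Real.pi / (q / (2 * v))) = √(2 * Real.pi * v) * (√q)⁻¹ := by
    rw [← Real.sqrt_inv, ← Real.sqrt_mul (by positivity)]
    congr 1
    field_simp
  calc ∫ z, Real.exp (-l * (y + z) ^ 2) ∂gaussianReal 0 v
      = (√(2 * Real.pi * v))⁻¹ * Real.exp (-l * y ^ 2 / q) *
          ∫ z : ℝ, Real.exp (-(q / (2 * v)) * (z + 2 * l * y * v / q) ^ 2) := by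
        simp_rw [integral_gaussianReal_eq_integral_smul hv, complete_square, integral_const_mul]
    _ = (√(2 * Real.pi * v))⁻¹ * Real.exp (-l * y ^ 2 / q) *
          (√(2 * Real.pi * v) * (√q)⁻¹) := by
        rw [integral_add_right_eq_self (fun z : ℝ ↦ Real.exp (-(q / (2 * v)) * z ^ 2)),
          integral_gaussian, sqrt_eq]
    _ = _ := by
        have : √(2 * Real.pi * v) ≠ 0 := by positivity
        field_simp

/-- The centred Gaussian law on `ℝᵈ` whose covariance matrix is `v` times the identity. -/
noncomputable def isotropicGaussian (d : ℕ) (v : ℝ≥0) : Measure (EuclideanSpace ℝ (Fin d)) :=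
  (Measure.pi fun _ : Fin d ↦ gaussianReal 0 v).map (WithLp.toLp 2)

instance isotropicGaussian.instIsProbabilityMeasure :
    IsProbabilityMeasure (isotropicGaussian d v) :=
  Measure.isProbabilityMeasure_map (by fun_prop)

lemma integral_exp_neg_mul_norm_sq_isotropicGaussian (hl : 0 ≤ l)
    (y : EuclideanSpace ℝ (Fin d)) (v : ℝ≥0) :
    ∫ z, Real.exp (-l * ‖y + z‖ ^ 2) ∂isotropicGaussian d v =
      (√(1 + 2 * l * v))⁻¹ ^ d * Real.exp (-l * ‖y‖ ^ 2 / (1 + 2 * l * v)) := by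
  have exp_eq_prod (z : Fin d → ℝ) : Real.exp (-l * ‖y + WithLp.toLp 2 z‖ ^ 2) =
      ∏ i, Real.exp (-l * (y i + z i) ^ 2) := by
    simp [← Real.exp_sum, EuclideanSpace.real_norm_sq_eq, Finset.mul_sum]
  rw [isotropicGaussian, integral_map (by fun_prop) (by fun_prop)]
  simp_rw [exp_eq_prod]
  rw [integral_fintype_prod_eq_prod (fun i z ↦ Real.exp (-l * (y i + z) ^ 2))]
  simp_rw [integral_exp_neg_mul_sq_gaussianReal hl]
  rw [Finset.prod_mul_distrib, ← Real.exp_sum, EuclideanSpace.real_norm_sq_eq, Finset.mul_sum,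
    Finset.sum_div]
  simp

lemma exp_neg_le_inv_sqrt_one_add_two_mul {s : ℝ} (hs : 0 ≤ s) :
    Real.exp (-s) ≤ (√(1 + 2 * s))⁻¹ := by
  rw [Real.exp_neg]
  gcongr
  rw [Real.sqrt_le_left (by positivity), ← Real.exp_nat_mul]
  push_cast
  linarith [Real.add_one_le_exp (2 * s)]

/- The Laplacian of `exp (-l ‖y‖²)` is `2 l (2 l ‖y‖² - d)` times the bump, and averaging over the
Gaussian of variance `v` adds about `v / 2` times that; `d ≤ l ‖y‖²` keeps a quarter of a factor
in hand for the higher order terms. -/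
lemma exp_neg_mul_one_add_le_integral_isotropicGaussian {y : EuclideanSpace ℝ (Fin d)}
    (hl : 0 ≤ l) (hy : d ≤ l * ‖y‖ ^ 2) (hv : 6 * (l * v) ≤ 1) :
    Real.exp (-l * ‖y‖ ^ 2) * (1 + d * (l * v) / 2) ≤
      ∫ z, Real.exp (-l * ‖y + z‖ ^ 2) ∂isotropicGaussian d v := by
  rw [integral_exp_neg_mul_norm_sq_isotropicGaussian hl, mul_assoc 2 l]
  have hs : 0 ≤ l * v := by positivity
  set s : ℝ := l * v
  set b : ℝ := l * ‖y‖ ^ 2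
  have hb : 3 / 2 * (d * s) ≤ 2 * s * b / (1 + 2 * s) := by
    rw [le_div_iff₀ (by positivity)]
    have : (0 : ℝ) ≤ d := by positivity
    nlinarith [mul_le_mul_of_nonneg_left hy hs, mul_nonneg this hs]
  calc Real.exp (-l * ‖y‖ ^ 2) * (1 + d * s / 2)
      ≤ Real.exp (-l * ‖y‖ ^ 2) * Real.exp (d * s / 2) := by
        gcongr
        linarith [Real.add_one_le_exp (d * s / 2)]
    _ ≤ Real.exp (d * -s) * Real.exp (-l * ‖y‖ ^ 2 / (1 + 2 * s)) := by
        rw [← Real.exp_add, ← Real.exp_add, Real.exp_le_exp]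
        have : -l * ‖y‖ ^ 2 / (1 + 2 * s) = -l * ‖y‖ ^ 2 + 2 * s * b / (1 + 2 * s) := by
          simp only [b]
          field_simp
          ring
        linarith
    _ ≤ _ := by
        rw [Real.exp_nat_mul]
        gcongr
        exact exp_neg_le_inv_sqrt_one_add_two_mul hs

end Gaussian

section Independence

variable {Ω : Type*} {m mΩ : MeasurableSpace Ω} {μ : Measure Ω}

lemma indepFun_pi_of_iIndepFun_prodMk {ι E F : Type*} [Finite ι] [MeasurableSpace E]
    [MeasurableSpace F] {X : ι → Ω → E} {Y : ι → Ω → F}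
    (hX : ∀ i, AEMeasurable (X i) μ) (hY : ∀ i, AEMeasurable (Y i) μ)
    (hXY : ∀ i, IndepFun (X i) (Y i) μ) (h : iIndepFun (fun i ω ↦ (X i ω, Y i ω)) μ) :
    IndepFun (fun ω i ↦ X i ω) (fun ω i ↦ Y i ω) μ := by
  have := Fintype.ofFinite ι
  have := h.isProbabilityMeasure
  have hXY' (i : ι) : AEMeasurable (fun ω ↦ (X i ω, Y i ω)) μ := (hX i).prodMk (hY i)
  have (i : ι) := Measure.isProbabilityMeasure_map (hX i)
  have (i : ι) := Measure.isProbabilityMeasure_map (hY i)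
  rw [indepFun_iff_map_prod_eq_prod_map_map (aemeasurable_pi_lambda _ hX)
    (aemeasurable_pi_lambda _ hY),
    (h.comp (fun _ ↦ Prod.fst) fun _ ↦ measurable_fst).map_fun_eq_pi_map hX,
    (h.comp (fun _ ↦ Prod.snd) fun _ ↦ measurable_snd).map_fun_eq_pi_map hY,
    ← (measurePreserving_arrowProdEquivProdArrow E F ι _ _).map_eq]
  simp_rw [← fun i ↦ (indepFun_iff_map_prod_eq_prod_map_map (hX i) (hY i)).1 (hXY i)]
  rw [← h.map_fun_eq_pi_map hXY', AEMeasurable.map_map_of_aemeasurable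
    (MeasurableEquiv.measurable _).aemeasurable (aemeasurable_pi_lambda _ hXY')]
  rfl

lemma setLIntegral_eq_of_indep {E F : Type*} [MeasurableSpace E] [MeasurableSpace F]
    {Y : Ω → E} {Z : Ω → F} {ν : Measure F} [IsFiniteMeasure μ] (hm : m ≤ mΩ)
    (hY : Measurable[m] Y) (hZ : Measurable Z) (hν : HasLaw Z ν μ)
    (hind : Indep m (MeasurableSpace.comap Z inferInstance) μ) {A : Set Ω}
    (hA : MeasurableSet[m] A) {φ : E × F → ℝ≥0∞} (hφ : Measurable φ) :
    ∫⁻ ω in A, φ (Y ω, Z ω) ∂μ = ∫⁻ ω in A, ∫⁻ z, φ (Y ω, z) ∂ν ∂μ := by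
  have hY' : Measurable Y := hY.mono hm le_rfl
  have : IsFiniteMeasure ν := hν.map_eq ▸ inferInstance
  have map_prodMk : (μ.restrict A).map (fun ω ↦ (Y ω, Z ω)) =
      ((μ.restrict A).map Y).prod ν := by
    refine (Measure.prod_eq fun S T hS hT ↦ ?_).symm
    rw [Measure.map_apply (hY'.prodMk hZ) (hS.prod hT), Measure.map_apply hY' hS,
      Measure.restrict_apply (hY' hS), ← hν.map_eq, Measure.map_apply hZ hT,
      ← (Indep_iff _ _ _).1 hind _ _ ((hY hS).inter hA) ⟨T, hT, rfl⟩,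
      Measure.restrict_apply ((hY'.prodMk hZ) (hS.prod hT)), mk_preimage_prod,
      inter_right_comm]
  rw [← lintegral_map hφ (hY'.prodMk hZ), map_prodMk, lintegral_prod _ hφ.aemeasurable,
    lintegral_map hφ.lintegral_prod_right' hY']

end Independence

namespace PathSpace

variable {d : ℕ}

@[fun_prop]
lemma measurable_eval (t : ℝ≥0) : Measurable fun X : PathSpace d ↦ X t :=
  (measurable_pi_apply t).comp (comap_measurable _)

/-- The filtration generated by the canonical process `X ↦ X t`. -/
noncomputable def canonicalFiltration (d : ℕ) :
    Filtration ℝ≥0 (PathSpace.instMeasurableSpace d) :=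
  .natural (fun t X ↦ X t) fun t ↦ (measurable_eval t).stronglyMeasurable

lemma measurable_eval_canonicalFiltration {s t : ℝ≥0} (h : s ≤ t) :
    Measurable[canonicalFiltration d t] fun X : PathSpace d ↦ X s :=
  ((Filtration.stronglyAdapted_natural _ s).mono ((canonicalFiltration d).mono h)).measurable

end PathSpace

namespace IsWienerMeasure

variable {d : ℕ} {α : ℝ≥0} {x : EuclideanSpace ℝ (Fin d)} {W : Measure (PathSpace d)}

lemma isProbabilityMeasure {α : ℝ} (hW : IsWienerMeasure α x W) : IsProbabilityMeasure W :=
  hW.indep.isProbabilityMeasure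

lemma ae_eval_zero (hW : IsWienerMeasure α x W) (hα : α ≠ 0) : ∀ᵐ X ∂W, X 0 = x := by
  filter_upwards [ae_all_iff.2 fun i ↦ (hW.coord i).eval_zero_ae_eq_zero] with X hX
  ext i
  have : √(α : ℝ) ≠ 0 := by positivity
  simpa [this, sub_eq_zero] using hX i

lemma hasLaw_sub_apply (hW : IsWienerMeasure α x W) (hα : α ≠ 0) (s t : ℝ≥0) (i : Fin d) :
    HasLaw (fun X : PathSpace d ↦ X (s + t) i - X s i) (gaussianReal 0 (α * t)) W := by
  have : 0 < (α : ℝ) := by positivity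
  convert gaussianReal_const_mul (((hW.coord i).shift s).hasLaw_eval t) √(α : ℝ) using 1
  · ext X
    field_simp
    ring
  · congr 1
    · simp
    · ext
      simp [Real.sq_sqrt]

lemma hasLaw_sub (hW : IsWienerMeasure α x W) (hα : α ≠ 0) (s t : ℝ≥0) :
    HasLaw (fun X ↦ X (s + t) - X s) (isotropicGaussian d (α * t)) W := by
  have : 0 < (α : ℝ) := by positivity
  have hind := hW.indep.comp (fun _ p ↦ √(α : ℝ) * (p (s + t) - p s)) fun _ ↦ by fun_prop
  have hind' : iIndepFun (fun i (X : PathSpace d) ↦ X (s + t) i - X s i) W := by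
    refine (iIndepFun_congr fun i ↦ ae_of_all _ fun X ↦ ?_).1 hind
    simp only [Function.comp_apply]
    field_simp
    ring
  have hpi := iIndepFun.hasLaw_pi (hW.hasLaw_sub_apply hα s t) hind'
  exact HasLaw.comp (X := fun (X : PathSpace d) i ↦ X (s + t) i - X s i) ⟨by fun_prop, rfl⟩ hpi

lemma indepFun_past_sub (hW : IsWienerMeasure α x W) (hα : α ≠ 0) (s t : ℝ≥0) :
    IndepFun (fun X (r : Iic s) ↦ X r) (fun X ↦ X (s + t) - X s) W := by
  have : 0 < (α : ℝ) := by positivity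
  let B (i : Fin d) (r : ℝ≥0) (X : PathSpace d) : ℝ := (X r i - x i) / √α
  have hB (i : Fin d) (r : ℝ≥0) : Measurable (B i r) := by fun_prop
  have hcoord (i : Fin d) : IndepFun (fun X (r : Iic s) ↦ B i r X)
      (fun X ↦ B i (s + t) X - B i s X) W :=
    ((hW.coord i).indepFun_shift s).symm.comp measurable_id (measurable_pi_apply t)
  have hpairs := hW.indep.comp (fun _ p ↦ (fun r : Iic s ↦ p r, p (s + t) - p s))
    fun _ ↦ by fun_prop
  have hind := indepFun_pi_of_iIndepFun_prodMk
    (fun i ↦ (measurable_pi_lambda _ fun r : Iic s ↦ hB i r).aemeasurable)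
    (fun i ↦ ((hB i (s + t)).sub (hB i s)).aemeasurable) hcoord hpairs
  have hcomp := hind.comp (φ := fun p (r : Iic s) ↦ x + √(α : ℝ) • WithLp.toLp 2 (p · r))
    (ψ := fun p ↦ √(α : ℝ) • WithLp.toLp 2 p) (by fun_prop) (by fun_prop)
  convert hcomp using 1
  · ext X r i
    simp only [Function.comp_apply, PiLp.add_apply, PiLp.smul_apply, smul_eq_mul]
    field_simp
    ring
  · ext X i
    simp only [PiLp.sub_apply, Pi.sub_apply, Function.comp_apply, PiLp.smul_apply, smul_eq_mul, B]
    field_simp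
    ring

lemma setLIntegral_eval_add (hW : IsWienerMeasure α x W) (hα : α ≠ 0) {s t : ℝ≥0}
    {A : Set (PathSpace d)} (hA : MeasurableSet[PathSpace.canonicalFiltration d s] A)
    {φ : EuclideanSpace ℝ (Fin d) → ℝ≥0∞} (hφ : Measurable φ) :
    ∫⁻ X in A, φ (X (s + t)) ∂W =
      ∫⁻ X in A, ∫⁻ z, φ (X s + z) ∂isotropicGaussian d (α * t) ∂W := by
  have := hW.isProbabilityMeasure
  have hind : Indep (PathSpace.canonicalFiltration d s)
      (MeasurableSpace.comap (fun X ↦ X (s + t) - X s) inferInstance) W := by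
    rw [PathSpace.canonicalFiltration, Filtration.natural_eq_comap]
    exact hW.indepFun_past_sub hα s t
  simpa using setLIntegral_eq_of_indep ((PathSpace.canonicalFiltration d).le s)
    (PathSpace.measurable_eval_canonicalFiltration le_rfl) (by fun_prop) (hW.hasLaw_sub hα s t)
    hind hA (hφ.comp measurable_add)

end IsWienerMeasure

section ExitTime

variable {d : ℕ} {V V' : Set (EuclideanSpace ℝ (Fin d))} {X : PathSpace d} {t : ℝ≥0}

lemma exitTime_le_of_notMem (ht : X t ∉ V) : exitTime V X ≤ t :=
  iInf₂_le t ht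

lemma exitTime_mono (h : V ⊆ V') : exitTime V X ≤ exitTime V' X :=
  le_iInf₂ fun _ ht ↦ exitTime_le_of_notMem fun hV ↦ ht (h hV)

lemma expectedExitTime_mono (W : Measure (PathSpace d)) (h : V ⊆ V') :
    expectedExitTime W V ≤ expectedExitTime W V' :=
  lintegral_mono fun _ ↦ exitTime_mono h

lemma IsWienerMeasure.expectedExitTime_eq_zero {α : ℝ≥0} {x : EuclideanSpace ℝ (Fin d)}
    {W : Measure (PathSpace d)} (hW : IsWienerMeasure α x W) (hα : α ≠ 0) (hx : x ∉ V) :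
    expectedExitTime W V = 0 := by
  refine lintegral_eq_zero_of_ae_eq_zero ?_
  filter_upwards [hW.ae_eval_zero hα] with X hX
  simpa using exitTime_le_of_notMem (t := 0) (hX ▸ hx)

end ExitTime

section SampledExit

variable {d : ℕ} {V : Set (EuclideanSpace ℝ (Fin d))} {X : PathSpace d} {h : ℝ≥0} {N : ℕ}

/-- The first time on the grid `0, h, 2 h, …` at which a path is outside `V`, capped at `N h`. -/
noncomputable def sampledExitTime (V : Set (EuclideanSpace ℝ (Fin d))) (h : ℝ≥0) (N : ℕ)
    (X : PathSpace d) : ℝ≥0 :=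
  hittingBtwn (fun (k : ℕ) (X : PathSpace d) ↦ X (k * h)) Vᶜ 0 N X * h

/-- The event that a path is in `V` at all of the grid times `0, h, …, N h`. -/
def sampledSurvival (V : Set (EuclideanSpace ℝ (Fin d))) (h : ℝ≥0) (N : ℕ) :
    Set (PathSpace d) :=
  {X | ∀ k ≤ N, X (k * h) ∈ V}

lemma measurableSet_sampledSurvival_canonicalFiltration (hV : MeasurableSet V) :
    MeasurableSet[PathSpace.canonicalFiltration d (N * h)] (sampledSurvival V h N) := by
  simp only [sampledSurvival, ofPred_forall]
  refine .iInter fun k ↦ .iInter fun hk ↦ ?_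
  exact PathSpace.measurable_eval_canonicalFiltration (by gcongr) hV

lemma measurableSet_sampledSurvival (hV : MeasurableSet V) :
    MeasurableSet (sampledSurvival V h N) :=
  (PathSpace.canonicalFiltration d).le _ _ (measurableSet_sampledSurvival_canonicalFiltration hV)

lemma sampledExitTime_zero : sampledExitTime V h 0 X = 0 := by
  simp [sampledExitTime, hittingBtwn_of_le]

lemma sampledExitTime_of_forall_mem (hX : ∀ k < N, X (k * h) ∈ V) :
    sampledExitTime V h N X = N * h := by
  rw [sampledExitTime]
  congr 2
  refine le_antisymm (hittingBtwn_le X) (not_lt.1 fun hlt ↦ ?_)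
  exact hittingBtwn_mem_set_of_hittingBtwn_lt hlt (hX _ hlt)

lemma sampledExitTime_succ_of_notMem_sampledSurvival (hX : X ∉ sampledSurvival V h N) :
    sampledExitTime V h (N + 1) X = sampledExitTime V h N X := by
  simp only [sampledSurvival, mem_ofPred_eq, not_forall] at hX
  obtain ⟨k, hk, hkV⟩ := hX
  rw [sampledExitTime, sampledExitTime,
    hittingBtwn_eq_hittingBtwn_of_exists N.le_succ ⟨k, ⟨k.zero_le, hk⟩, hkV⟩]

lemma eval_sampledExitTime_notMem (ht : sampledExitTime V h N X < N * h) :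
    X (sampledExitTime V h N X) ∉ V := by
  have hlt : hittingBtwn (fun (k : ℕ) (X : PathSpace d) ↦ X (k * h)) Vᶜ 0 N X < N := by
    exact_mod_cast lt_of_mul_lt_mul_right ht h.2
  exact hittingBtwn_mem_set_of_hittingBtwn_lt hlt

lemma eval_sampledExitTime_sub_mem (h₀ : X 0 ∈ V) : X (sampledExitTime V h N X - h) ∈ V := by
  rw [sampledExitTime]
  rcases hk : hittingBtwn (fun (k : ℕ) (X : PathSpace d) ↦ X (k * h)) Vᶜ 0 N X with _ | j
  · simpa using h₀
  · have := notMem_of_lt_hittingBtwn (j.lt_succ_self.trans_eq hk.symm) j.zero_le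
    simpa [add_mul] using this

end SampledExit

section SampledLyapunov

variable {d : ℕ} {V : Set (EuclideanSpace ℝ (Fin d))} {κ h : ℝ≥0} {N : ℕ}
  {u : EuclideanSpace ℝ (Fin d) → ℝ≥0}

/-- The process `κ t + u (X t)` at the time `t` of the first exit of the sampled path. It is a
supermartingale in `N` when `u` loses at least `κ h` on average over each step taken from `V`. -/
noncomputable def sampledLyapunov (κ : ℝ≥0) (u : EuclideanSpace ℝ (Fin d) → ℝ≥0)
    (V : Set (EuclideanSpace ℝ (Fin d))) (h : ℝ≥0) (N : ℕ) (X : PathSpace d) : ℝ≥0 :=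
  κ * sampledExitTime V h N X + u (X (sampledExitTime V h N X))

lemma sampledLyapunov_of_mem_sampledSurvival {X : PathSpace d}
    (hX : X ∈ sampledSurvival V h N) :
    sampledLyapunov κ u V h N X = κ * (N * h) + u (X (N * h)) := by
  rw [sampledLyapunov, sampledExitTime_of_forall_mem fun k hk ↦ hX k hk.le]

open Classical in
lemma sampledLyapunov_succ :
    sampledLyapunov κ u V h (N + 1) = (sampledSurvival V h N).piecewise
      (fun X ↦ κ * (N * h + h) + u (X (N * h + h))) (sampledLyapunov κ u V h N) := by
  ext X : 1
  by_cases hX : X ∈ sampledSurvival V h N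
  · rw [piecewise_eq_of_mem _ _ _ hX, sampledLyapunov,
      sampledExitTime_of_forall_mem fun k hk ↦ hX k (Nat.lt_succ_iff.1 hk), Nat.cast_succ,
      add_one_mul]
  · rw [piecewise_eq_of_notMem _ _ _ hX, sampledLyapunov, sampledLyapunov,
      sampledExitTime_succ_of_notMem_sampledSurvival hX]

lemma measurable_sampledLyapunov (hV : MeasurableSet V) (hu : Measurable u) :
    Measurable (sampledLyapunov κ u V h N) := by
  classical
  induction N with
  | zero =>
    unfold sampledLyapunov
    simp only [sampledExitTime_zero]
    fun_prop
  | succ N ih =>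
    rw [sampledLyapunov_succ]
    exact .piecewise (measurableSet_sampledSurvival hV) (by fun_prop) ih

variable {α : ℝ≥0} {x : EuclideanSpace ℝ (Fin d)} {W : Measure (PathSpace d)}

lemma lintegral_sampledLyapunov_succ_le (hW : IsWienerMeasure α x W) (hα : α ≠ 0)
    (hV : MeasurableSet V) (hu : Measurable u)
    (hstep : ∀ y ∈ V, ∫⁻ z, u (y + z) ∂isotropicGaussian d (α * h) + κ * h ≤ u y) :
    ∫⁻ X, sampledLyapunov κ u V h (N + 1) X ∂W ≤ ∫⁻ X, sampledLyapunov κ u V h N X ∂W := by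
  classical
  have hA := measurableSet_sampledSurvival (N := N) (h := h) hV
  rw [← lintegral_add_compl _ hA,
    ← lintegral_add_compl (fun X ↦ (sampledLyapunov κ u V h N X : ℝ≥0∞)) hA]
  gcongr ?_ + ?_
  · calc ∫⁻ X in sampledSurvival V h N, sampledLyapunov κ u V h (N + 1) X ∂W
        = ∫⁻ X in sampledSurvival V h N, κ * (N * h + h) + u (X (N * h + h)) ∂W :=
          setLIntegral_congr_fun hA fun X hX ↦ by
            simp [sampledLyapunov_succ, piecewise_eq_of_mem _ _ _ hX]
      _ = ∫⁻ X in sampledSurvival V h N,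
            ∫⁻ z, κ * (N * h + h) + u (X (N * h) + z) ∂isotropicGaussian d (α * h) ∂W :=
          hW.setLIntegral_eval_add hα (measurableSet_sampledSurvival_canonicalFiltration hV)
            (φ := fun y ↦ κ * (N * h + h) + u y) (by fun_prop)
      _ ≤ ∫⁻ X in sampledSurvival V h N, sampledLyapunov κ u V h N X ∂W := by
          refine setLIntegral_mono' hA fun X hX ↦ ?_
          rw [lintegral_add_left measurable_const, lintegral_const, measure_univ, mul_one,
            sampledLyapunov_of_mem_sampledSurvival hX]
          push_cast
          rw [mul_add, add_assoc, add_comm (κ * h : ℝ≥0∞)]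
          gcongr
          exact hstep _ (hX N le_rfl)
  · refine (setLIntegral_congr_fun hA.compl fun X hX ↦ ?_).le
    rw [sampledLyapunov_succ, piecewise_eq_of_notMem _ _ _ hX]

lemma lintegral_sampledLyapunov_le (hW : IsWienerMeasure α x W) (hα : α ≠ 0)
    (hV : MeasurableSet V) (hu : Measurable u)
    (hstep : ∀ y ∈ V, ∫⁻ z, u (y + z) ∂isotropicGaussian d (α * h) + κ * h ≤ u y) (N : ℕ) :
    ∫⁻ X, sampledLyapunov κ u V h N X ∂W ≤ u x := by
  have := hW.isProbabilityMeasure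
  induction N with
  | zero =>
    have : ∀ᵐ X ∂W, (sampledLyapunov κ u V h 0 X : ℝ≥0∞) = u x := by
      filter_upwards [hW.ae_eval_zero hα] with X hX
      simp [sampledLyapunov, sampledExitTime_zero, hX]
    simp [lintegral_congr_ae this]
  | succ N ih => exact (lintegral_sampledLyapunov_succ_le hW hα hV hu hstep).trans ih

end SampledLyapunov

section LyapunovBound

open Filter Topology

variable {d : ℕ} {V : Set (EuclideanSpace ℝ (Fin d))} {κ a : ℝ≥0}
  {u : EuclideanSpace ℝ (Fin d) → ℝ≥0} {X : PathSpace d} {h : ℕ → ℝ≥0} {N : ℕ → ℕ}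

lemma mul_exitTime_add_le_of_tendsto_sampledExitTime (hu : Continuous u)
    (ha : ∀ y ∈ V, a ≤ u y) (h₀ : X 0 ∈ V) {l : Filter ℕ} [l.NeBot] (hh : Tendsto h l (𝓝 0))
    (hN : Tendsto (fun n ↦ N n * h n) l atTop) {t : ℝ≥0}
    (ht : Tendsto (fun n ↦ sampledExitTime V (h n) (N n) X) l (𝓝 t)) :
    κ * exitTime V X + a ≤ (κ * t + u (X t) : ℝ≥0) := by
  have exitTime_le : exitTime V X ≤ t := by
    refine ge_of_tendsto (ENNReal.tendsto_coe.2 ht) ?_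
    filter_upwards [ht.eventually_lt_const (lt_add_one t), hN.eventually_ge_atTop (t + 1)]
      with n hn hn' using exitTime_le_of_notMem (eval_sampledExitTime_notMem (hn.trans_le hn'))
  have le_eval : a ≤ u (X t) := by
    have hback : Tendsto (fun n ↦ sampledExitTime V (h n) (N n) X - h n) l (𝓝 t) := by
      simpa using ht.sub hh
    exact ge_of_tendsto' ((hu.comp X.continuous).continuousAt.tendsto.comp hback) fun n ↦
      ha _ (eval_sampledExitTime_sub_mem h₀)
  push_cast
  gcongr

/- The sampled exit times are bounded along any ultrafilter along which the sampled values stay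
below a finite `b`, so they converge along it. -/
lemma mul_exitTime_add_le_liminf_sampledLyapunov (hκ : κ ≠ 0) (hu : Continuous u)
    (ha : ∀ y ∈ V, a ≤ u y) (h₀ : X 0 ∈ V) (hh : Tendsto h atTop (𝓝 0))
    (hN : Tendsto (fun n ↦ N n * h n) atTop atTop) :
    κ * exitTime V X + a ≤
      liminf (fun n ↦ (sampledLyapunov κ u V (h n) (N n) X : ℝ≥0∞)) atTop := by
  refine le_of_forall_gt_imp_ge_of_dense fun b hb ↦ ?_
  induction b with
  | top => exact le_top
  | coe b =>
    have : (atTop ⊓ 𝓟 {n | sampledLyapunov κ u V (h n) (N n) X < b}).NeBot :=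
      frequently_mem_iff_neBot.1 <|
        (frequently_lt_of_liminf_lt (h := hb)).mono fun n ↦ ENNReal.coe_lt_coe.1
    set l : Ultrafilter ℕ := .of (atTop ⊓ 𝓟 {n | sampledLyapunov κ u V (h n) (N n) X < b})
    have hl : (l : Filter ℕ) ≤ atTop := (Ultrafilter.of_le _).trans inf_le_left
    have lt_b : ∀ᶠ n in l, sampledLyapunov κ u V (h n) (N n) X < b :=
      (Ultrafilter.of_le _).trans inf_le_right (mem_principal_self _)
    have le_div : ∀ᶠ n in l, sampledExitTime V (h n) (N n) X ∈ Icc 0 (b / κ) := by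
      filter_upwards [lt_b] with n hn
      rw [mem_Icc, le_div_iff₀' (pos_iff_ne_zero.2 hκ)]
      exact ⟨zero_le, le_self_add.trans hn.le⟩
    obtain ⟨t, -, ht⟩ := isCompact_Icc.ultrafilter_le_nhds' (l.map _) le_div
    have lyapunov_tendsto : Tendsto (fun n ↦ sampledLyapunov κ u V (h n) (N n) X) l
        (𝓝 (κ * t + u (X t))) :=
      (tendsto_const_nhds.mul ht).add ((hu.comp X.continuous).continuousAt.tendsto.comp ht)
    calc κ * exitTime V X + a
        ≤ (κ * t + u (X t) : ℝ≥0) := mul_exitTime_add_le_of_tendsto_sampledExitTime hu ha h₀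
          (hh.mono_left hl) (hN.mono_left hl) ht
      _ ≤ b := by
        exact_mod_cast le_of_tendsto lyapunov_tendsto (lt_b.mono fun n ↦ le_of_lt)

theorem IsWienerMeasure.mul_expectedExitTime_add_le {α : ℝ≥0} {x : EuclideanSpace ℝ (Fin d)}
    {W : Measure (PathSpace d)} (hW : IsWienerMeasure α x W) (hα : α ≠ 0) (hV : MeasurableSet V)
    (hκ : κ ≠ 0) (hu : Continuous u) (ha : ∀ y ∈ V, a ≤ u y)
    (hstep : ∀ᶠ h : ℝ≥0 in 𝓝[>] 0,
      ∀ y ∈ V, ∫⁻ z, u (y + z) ∂isotropicGaussian d (α * h) + κ * h ≤ u y) (hx : x ∈ V) :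
    κ * expectedExitTime W V + a ≤ u x := by
  have := hW.isProbabilityMeasure
  let h (n : ℕ) : ℝ≥0 := ((n : ℝ≥0) + 1)⁻¹
  let N (n : ℕ) : ℕ := (n + 1) ^ 2
  have succ_atTop : Tendsto (fun n : ℕ ↦ (n : ℝ≥0) + 1) atTop atTop :=
    tendsto_atTop_mono (fun _ ↦ le_self_add) tendsto_natCast_atTop_atTop
  have hh : Tendsto h atTop (𝓝[>] 0) := tendsto_inv_atTop_nhdsGT_zero.comp succ_atTop
  have hN : Tendsto (fun n ↦ N n * h n) atTop atTop :=
    succ_atTop.congr fun n ↦ by simp [N, h, sq]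
  have pathwise : ∀ᵐ X ∂W, κ * exitTime V X + a ≤
      liminf (fun n ↦ (sampledLyapunov κ u V (h n) (N n) X : ℝ≥0∞)) atTop := by
    filter_upwards [hW.ae_eval_zero hα] with X hX
    exact mul_exitTime_add_le_liminf_sampledLyapunov hκ hu ha (hX ▸ hx)
      (hh.mono_right nhdsWithin_le_nhds) hN
  calc κ * expectedExitTime W V + a
      = ∫⁻ X, κ * exitTime V X + a ∂W := by
        rw [lintegral_add_right _ measurable_const, lintegral_const_mul' _ _ ENNReal.coe_ne_top,
          lintegral_const, measure_univ, mul_one, expectedExitTime]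
    _ ≤ ∫⁻ X, liminf (fun n ↦ (sampledLyapunov κ u V (h n) (N n) X : ℝ≥0∞)) atTop ∂W :=
        lintegral_mono_ae pathwise
    _ ≤ liminf (fun n ↦ ∫⁻ X, sampledLyapunov κ u V (h n) (N n) X ∂W) atTop :=
        lintegral_liminf_le fun n ↦
          (measurable_sampledLyapunov hV hu.measurable).coe_nnreal_ennreal
    _ ≤ u x := by
        refine liminf_le_of_frequently_le' (Eventually.frequently ?_)
        filter_upwards [hh.eventually hstep] with n hn
        exact lintegral_sampledLyapunov_le hW hα hV hu.measurable hn (N n)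

end LyapunovBound

section Annulus

open Filter Topology

/-- The closed annulus of inner radius `r₁` and outer radius `r₂` centred at `c`. -/
def closedAnnulus {E : Type*} [PseudoMetricSpace E] (c : E) (r₁ r₂ : ℝ) : Set E :=
  closedBall c r₂ \ ball c r₁

lemma isClosed_closedAnnulus {E : Type*} [PseudoMetricSpace E] (c : E) (r₁ r₂ : ℝ) :
    IsClosed (closedAnnulus c r₁ r₂) :=
  isClosed_closedBall.sdiff isOpen_ball

lemma mem_closedAnnulus {E : Type*} [PseudoMetricSpace E] {c y : E} {r₁ r₂ : ℝ} :
    y ∈ closedAnnulus c r₁ r₂ ↔ r₁ ≤ dist y c ∧ dist y c ≤ r₂ := by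
  simp [closedAnnulus, and_comm]

variable {d : ℕ} {l r₁ r₂ : ℝ} {α : ℝ≥0} {c x y : EuclideanSpace ℝ (Fin d)}

/-- The complement of a Gaussian bump centred at `c`. With `l = d / r₁²` it is strictly
superharmonic outside the ball of radius `r₁`, and it serves as the Lyapunov function of annuli. -/
noncomputable def gaussianBarrier (l : ℝ) (c y : EuclideanSpace ℝ (Fin d)) : ℝ≥0 :=
  (1 - Real.exp (-l * dist y c ^ 2)).toNNReal

/-- A lower bound for the rate at which the barrier of the annulus with radii `r₁` and `r₂`
decreases on average along Brownian motion of variance `α`. -/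
noncomputable def barrierRate (d : ℕ) (r₁ r₂ : ℝ) (α : ℝ≥0) : ℝ≥0 :=
  (Real.exp (-(d / r₁ ^ 2) * r₂ ^ 2) * (d * (d / r₁ ^ 2 * α) / 2)).toNNReal

/-- The constant of the exit time estimate for the annulus with radii `r₁` and `r₂`, for Brownian
motion of variance `1`. -/
noncomputable def annulusConst (d : ℕ) (r₁ r₂ : ℝ) : ℝ :=
  4 * r₂ * Real.exp (d * (r₂ / r₁) ^ 2)

lemma annulusConst_pos (d : ℕ) (r₁ : ℝ) {r₂ : ℝ} (hr₂ : 0 < r₂) :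
    0 < annulusConst d r₁ r₂ := by
  unfold annulusConst
  positivity

lemma annulusConst_anti (d : ℕ) {r r₁ r₂ : ℝ} (hr : 0 < r) (h : r ≤ r₁) (hr₂ : 0 ≤ r₂) :
    annulusConst d r₁ r₂ ≤ annulusConst d r r₂ := by
  have : 0 < r₁ := hr.trans_le h
  unfold annulusConst
  gcongr

lemma annulusConst_mul (d : ℕ) {k : ℝ} (hk : k ≠ 0) (r₁ r₂ : ℝ) :
    annulusConst d (k * r₁) (k * r₂) = k * annulusConst d r₁ r₂ := by
  rw [annulusConst, annulusConst, mul_div_mul_left _ _ hk]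
  ring

lemma coe_gaussianBarrier (hl : 0 ≤ l) (c y : EuclideanSpace ℝ (Fin d)) :
    (gaussianBarrier l c y : ℝ) = 1 - Real.exp (-l * dist y c ^ 2) := by
  refine Real.coe_toNNReal _ (sub_nonneg.2 (Real.exp_le_one_iff.2 ?_))
  rw [neg_mul, neg_nonpos]
  positivity

lemma continuous_gaussianBarrier : Continuous (gaussianBarrier l c) :=
  continuous_real_toNNReal.comp (by fun_prop)

lemma integrable_exp_neg_mul_norm_sq (hl : 0 ≤ l) (μ : Measure (EuclideanSpace ℝ (Fin d)))
    [IsFiniteMeasure μ] (y : EuclideanSpace ℝ (Fin d)) :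
    Integrable (fun z ↦ Real.exp (-l * ‖y + z‖ ^ 2)) μ := by
  refine .of_bound (by fun_prop) 1 (ae_of_all _ fun z ↦ ?_)
  rw [Real.norm_of_nonneg (Real.exp_nonneg _), Real.exp_le_one_iff, neg_mul, neg_nonpos]
  positivity

lemma coe_gaussianBarrier_add (hl : 0 ≤ l) (c y z : EuclideanSpace ℝ (Fin d)) :
    (gaussianBarrier l c (y + z) : ℝ) = 1 - Real.exp (-l * ‖(y - c) + z‖ ^ 2) := by
  rw [coe_gaussianBarrier hl, dist_eq_norm, sub_add_eq_add_sub]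

lemma integrable_gaussianBarrier_add (hl : 0 ≤ l) (μ : Measure (EuclideanSpace ℝ (Fin d)))
    [IsFiniteMeasure μ] (c y : EuclideanSpace ℝ (Fin d)) :
    Integrable (fun z ↦ (gaussianBarrier l c (y + z) : ℝ)) μ := by
  simp_rw [coe_gaussianBarrier_add hl]
  exact (integrable_const 1).sub (integrable_exp_neg_mul_norm_sq hl μ _)

lemma integral_gaussianBarrier_add (hl : 0 ≤ l) (μ : Measure (EuclideanSpace ℝ (Fin d)))
    [IsProbabilityMeasure μ] (c y : EuclideanSpace ℝ (Fin d)) :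
    ∫ z, (gaussianBarrier l c (y + z) : ℝ) ∂μ =
      1 - ∫ z, Real.exp (-l * ‖(y - c) + z‖ ^ 2) ∂μ := by
  simp_rw [coe_gaussianBarrier_add hl]
  rw [integral_sub (integrable_const 1) (integrable_exp_neg_mul_norm_sq hl μ _)]
  simp

lemma barrierRate_ne_zero (hd : d ≠ 0) (hr₁ : r₁ ≠ 0) (hα : α ≠ 0) :
    barrierRate d r₁ r₂ α ≠ 0 := by
  have : 0 < Real.exp (-(d / r₁ ^ 2) * r₂ ^ 2) * (d * (d / r₁ ^ 2 * α) / 2) := by positivity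
  simpa [barrierRate] using this

lemma le_div_sq_mul_sq {p r ρ : ℝ} (hp : 0 ≤ p) (hr : 0 < r) (h : r ≤ ρ) :
    p ≤ p / r ^ 2 * ρ ^ 2 := by
  rw [div_mul_eq_mul_div, le_div_iff₀ (by positivity)]
  gcongr

lemma lintegral_gaussianBarrier_add_barrierRate_le (hr₁ : 0 < r₁) {h : ℝ≥0}
    (hh : 6 * (d / r₁ ^ 2 * (α * h)) ≤ 1) (hy : y ∈ closedAnnulus c r₁ r₂) :
    ∫⁻ z, gaussianBarrier (d / r₁ ^ 2) c (y + z) ∂isotropicGaussian d (α * h) +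
      barrierRate d r₁ r₂ α * h ≤ gaussianBarrier (d / r₁ ^ 2) c y := by
  have hl : 0 ≤ d / r₁ ^ 2 := by positivity
  obtain ⟨h₁, h₂⟩ := mem_closedAnnulus.1 hy
  have bump_le := exp_neg_mul_one_add_le_integral_isotropicGaussian hl
    ((le_div_sq_mul_sq d.cast_nonneg hr₁ h₁).trans_eq (by rw [dist_eq_norm]))
    (v := α * h) (by simpa)
  have rate_le : barrierRate d r₁ r₂ α * h ≤
      Real.exp (-(d / r₁ ^ 2) * dist y c ^ 2) * (d * (d / r₁ ^ 2 * (α * h)) / 2) := by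
    calc barrierRate d r₁ r₂ α * h
        = Real.exp (-(d / r₁ ^ 2 * r₂ ^ 2)) * (d * (d / r₁ ^ 2 * (α * h)) / 2) := by
          rw [barrierRate, Real.coe_toNNReal _ (by positivity)]
          ring_nf
      _ ≤ _ := by
          rw [neg_mul]
          gcongr
  rw [lintegral_coe_eq_integral _ (integrable_gaussianBarrier_add hl _ c y), ← ENNReal.coe_mul,
    ← ENNReal.ofReal_coe_nnreal, ← ENNReal.ofReal_add (integral_nonneg fun _ ↦ NNReal.coe_nonneg _)
    (NNReal.coe_nonneg _), ← ENNReal.ofReal_coe_nnreal, integral_gaussianBarrier_add hl,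
    coe_gaussianBarrier hl]
  gcongr
  rw [← dist_eq_norm] at bump_le
  push_cast at bump_le ⊢
  linarith

lemma eventually_lintegral_gaussianBarrier_add_barrierRate_le (hr₁ : 0 < r₁) (r₂ : ℝ) (α : ℝ≥0)
    (c : EuclideanSpace ℝ (Fin d)) :
    ∀ᶠ h : ℝ≥0 in 𝓝[>] 0, ∀ y ∈ closedAnnulus c r₁ r₂,
      ∫⁻ z, gaussianBarrier (d / r₁ ^ 2) c (y + z) ∂isotropicGaussian d (α * h) +
        barrierRate d r₁ r₂ α * h ≤ gaussianBarrier (d / r₁ ^ 2) c y := by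
  have small_step : Tendsto (fun h : ℝ≥0 ↦ 6 * (d / r₁ ^ 2 * (α * h) : ℝ)) (𝓝[>] 0) (𝓝 0) :=
    (Continuous.tendsto' (by fun_prop) _ _ (by simp)).mono_left nhdsWithin_le_nhds
  filter_upwards [small_step.eventually_le_const one_pos] with h hh y hy
  exact lintegral_gaussianBarrier_add_barrierRate_le hr₁ hh hy

lemma exp_neg_sub_exp_neg_le_sub {s t : ℝ} (hs : 0 ≤ s) (hst : s ≤ t) :
    Real.exp (-s) - Real.exp (-t) ≤ t - s := by
  calc Real.exp (-s) - Real.exp (-t) = Real.exp (-s) * (1 - Real.exp (-(t - s))) := by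
        rw [mul_one_sub, ← Real.exp_add]
        ring_nf
    _ ≤ 1 - Real.exp (-(t - s)) := by
        refine mul_le_of_le_one_left (sub_nonneg.2 (Real.exp_le_one_iff.2 ?_))
          (Real.exp_le_one_iff.2 ?_) <;> linarith
    _ ≤ t - s := by linarith [Real.one_sub_le_exp_neg (t - s)]

lemma one_sub_exp_neg_le_gaussianBarrier (hr₁ : 0 < r₁) (hy : r₁ ≤ dist y c) :
    (1 - Real.exp (-d)).toNNReal ≤ gaussianBarrier (d / r₁ ^ 2) c y := by
  refine Real.toNNReal_le_toNNReal (sub_le_sub_left (Real.exp_le_exp.2 ?_) _)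
  rw [neg_mul, neg_le_neg_iff]
  exact le_div_sq_mul_sq d.cast_nonneg hr₁ hy

lemma barrierRate_mul_annulusConst (hr₁ : r₁ ≠ 0) (hα : α ≠ 0) :
    barrierRate d r₁ r₂ α * (annulusConst d r₁ r₂ / α) = 2 * d * (d / r₁ ^ 2) * r₂ := by
  have hα' : (α : ℝ) ≠ 0 := by positivity
  rw [barrierRate, Real.coe_toNNReal _ (by positivity), annulusConst, neg_mul, Real.exp_neg]
  field_simp
  norm_num

lemma gaussianBarrier_le_barrierRate_mul_add (hr₁ : 0 < r₁) (hα : α ≠ 0)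
    (hy : y ∈ closedAnnulus c r₁ r₂) :
    (gaussianBarrier (d / r₁ ^ 2) c y : ℝ) ≤
      barrierRate d r₁ r₂ α * (annulusConst d r₁ r₂ / α * (dist y c - r₁)) +
        (1 - Real.exp (-d)) := by
  obtain ⟨h₁, h₂⟩ := mem_closedAnnulus.1 hy
  have d_le_sq : (d : ℝ) ≤ d * d := mod_cast Nat.le_mul_self d
  have exponent_le : d / r₁ ^ 2 * dist y c ^ 2 - d ≤
      2 * d * (d / r₁ ^ 2) * r₂ * (dist y c - r₁) := by
    calc d / r₁ ^ 2 * dist y c ^ 2 - d = d / r₁ ^ 2 * (dist y c + r₁) * (dist y c - r₁) := by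
          field_simp
          ring
      _ ≤ d * d / r₁ ^ 2 * (r₂ + r₂) * (dist y c - r₁) := by
          have := sub_nonneg.2 h₁
          gcongr
          exact h₁.trans h₂
      _ = 2 * d * (d / r₁ ^ 2) * r₂ * (dist y c - r₁) := by ring
  rw [coe_gaussianBarrier (by positivity), ← mul_assoc, barrierRate_mul_annulusConst hr₁.ne' hα,
    neg_mul]
  linarith [exp_neg_sub_exp_neg_le_sub d.cast_nonneg (le_div_sq_mul_sq d.cast_nonneg hr₁ h₁)]

theorem IsWienerMeasure.expectedExitTime_closedAnnulus_le {W : Measure (PathSpace d)}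
    (hW : IsWienerMeasure α x W) (hα : α ≠ 0) (hr₁ : 0 < r₁) :
    expectedExitTime W (closedAnnulus c r₁ r₂) ≤
      ENNReal.ofReal (annulusConst d r₁ r₂ / α * (dist x c - r₁)) := by
  by_cases hx : x ∈ closedAnnulus c r₁ r₂
  swap
  · rw [hW.expectedExitTime_eq_zero (mod_cast hα) hx]
    exact zero_le
  have hd : d ≠ 0 := by
    rintro rfl
    have := (mem_closedAnnulus.1 hx).1
    rw [Subsingleton.elim x c, dist_self] at this
    linarith
  have hκ : barrierRate d r₁ r₂ α ≠ 0 := barrierRate_ne_zero hd hr₁.ne' hα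
  have lyapunov := hW.mul_expectedExitTime_add_le hα
    (isClosed_closedAnnulus c r₁ r₂).measurableSet hκ continuous_gaussianBarrier
    (fun y hy ↦ one_sub_exp_neg_le_gaussianBarrier hr₁ (mem_closedAnnulus.1 hy).1)
    (eventually_lintegral_gaussianBarrier_add_barrierRate_le hr₁ r₂ α c) hx
  have barrier_le : (gaussianBarrier (d / r₁ ^ 2) c x : ℝ≥0∞) ≤
      barrierRate d r₁ r₂ α * ENNReal.ofReal (annulusConst d r₁ r₂ / α * (dist x c - r₁)) +
        (1 - Real.exp (-d)).toNNReal := by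
    rw [← ENNReal.ofReal_coe_nnreal, ← ENNReal.ofReal_coe_nnreal (p := barrierRate d r₁ r₂ α),
      ← ENNReal.ofReal_mul NNReal.zero_le_coe]
    exact (ENNReal.ofReal_le_ofReal (gaussianBarrier_le_barrierRate_mul_add hr₁ hα hx)).trans
      ENNReal.ofReal_add_le
  have := (ENNReal.add_le_add_iff_right ENNReal.coe_ne_top).1 (lyapunov.trans barrier_le)
  exact (ENNReal.mul_le_mul_iff_right (by simpa) ENNReal.coe_ne_top).1 this

end Annulus

section FrontierThickening

lemma inter_frontier_nonempty_of_isPreconnected {X : Type*} [TopologicalSpace X] {s t : Set X}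
    (ht : IsPreconnected t) (hts : (t ∩ s).Nonempty) (hts' : (t ∩ sᶜ).Nonempty) :
    (t ∩ frontier s).Nonempty := by
  by_contra! h
  obtain ⟨y, hyt, hys⟩ := hts
  obtain ⟨x, hxt, hxs⟩ := hts'
  have interior_of_closure {z : X} (hzt : z ∈ t) (hzs : z ∈ closure s) : z ∈ interior s :=
    by_contra fun hz ↦ h.subset ⟨hzt, hzs, hz⟩
  have t_subset : t ⊆ interior s := ht.subset_of_closure_inter_subset isOpen_interior
    ⟨y, hyt, interior_of_closure hyt (subset_closure hys)⟩
    fun z hz ↦ interior_of_closure hz.2 (closure_mono interior_subset hz.1)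
  exact hxs (interior_subset (t_subset hxt))

variable {E : Type*} [SeminormedAddCommGroup E] [NormedSpace ℝ E] {s : Set E} {x : E}

lemma infEDist_frontier_le_of_notMem (hx : x ∉ s) : infEDist x (frontier s) ≤ infEDist x s := by
  refine le_infEDist.2 fun y hy ↦ ?_
  obtain ⟨z, hz, hzs⟩ := inter_frontier_nonempty_of_isPreconnected
    (convex_segment x y).isPreconnected ⟨y, right_mem_segment ℝ x y, hy⟩
    ⟨x, left_mem_segment ℝ x y, hx⟩
  have dist_le : dist x z ≤ dist x y := by
    linarith [dist_add_dist_of_mem_segment hz, dist_nonneg (x := z) (y := y)]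
  rw [edist_dist x y]
  exact (infEDist_le_edist_of_mem hzs).trans
    ((edist_dist x z).trans_le (ENNReal.ofReal_le_ofReal dist_le))

lemma frontier_thickening_subset_cthickening_frontier (δ : ℝ) (s : Set E) :
    frontier (thickening δ s) ⊆ cthickening δ (frontier s) := by
  intro x hx
  have hxs : infEDist x s = ENNReal.ofReal δ := frontier_thickening_subset s hx
  refine mem_cthickening_iff.2 ((infEDist_frontier_le_of_notMem fun hs ↦ ?_).trans hxs.le)
  rw [infEDist_zero_of_mem hs, eq_comm, ENNReal.ofReal_eq_zero] at hxs
  simp [thickening_of_nonpos hxs] at hx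

lemma cthickening_frontier_thickening_subset {δ η : ℝ} (hδ : 0 ≤ δ) (hη : 0 ≤ η) (s : Set E) :
    cthickening η (frontier (thickening δ s)) ⊆ cthickening (η + δ) (frontier s) :=
  (cthickening_subset_of_subset η (frontier_thickening_subset_cthickening_frontier δ s)).trans
    (cthickening_cthickening_subset hη hδ _)

end FrontierThickening

section ExteriorBall

/-- The constant of the exit time estimate near the boundary, for Brownian motion of variance `1`
and a domain of diameter `D` that satisfies the exterior ball condition with radius `r`. -/
noncomputable def exteriorBallConst (d : ℕ) (r D : ℝ) : ℝ :=
  4 * annulusConst d (r / 2) (2 * r + D)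

lemma exteriorBallConst_nonneg (d : ℕ) {r D : ℝ} (hr : 0 < r) (hD : 0 ≤ D) :
    0 ≤ exteriorBallConst d r D :=
  mul_nonneg zero_le_four (annulusConst_pos d _ (by positivity)).le

lemma exteriorBallConst_mul (d : ℕ) {k : ℝ} (hk : k ≠ 0) (r D : ℝ) :
    exteriorBallConst d (k * r) (k * D) = k * exteriorBallConst d r D := by
  rw [exteriorBallConst, exteriorBallConst, mul_left_comm k, ← annulusConst_mul d hk]
  ring_nf

variable {d : ℕ} {r δ : ℝ} {α : ℝ≥0} {S U : Set (EuclideanSpace ℝ (Fin d))}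

namespace ExteriorBallCondition

lemma smul {k : ℝ} (hE : ExteriorBallCondition U r) (hk : 0 < k) :
    ExteriorBallCondition (k • U) (k * r) := by
  have frontier_smul : frontier (k • U) = k • frontier U :=
    ((Homeomorph.smulOfNeZero k hk.ne').image_frontier U).symm
  have closure_smul : closure (k • U) = k • closure U :=
    ((Homeomorph.smulOfNeZero k hk.ne').image_closure U).symm
  rintro x hx
  obtain ⟨z, hz, rfl⟩ := frontier_smul.subset hx
  obtain ⟨y, hy⟩ := hE z hz
  have closedBall_smul : k • closedBall y r = closedBall (k • y) (k * r) := by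
    rw [smul_closedBall' hk.ne', Real.norm_of_nonneg hk.le]
  refine ⟨k • y, ?_⟩
  rw [closure_smul, ← closedBall_smul, ← smul_set_inter₀ hk.ne', hy, smul_set_singleton]

lemma exists_subset_closedAnnulus (hE : ExteriorBallCondition U r) (hU : IsOpen U)
    (hb : Bornology.IsBounded U) (hS : S ⊆ thickening δ U) {z : EuclideanSpace ℝ (Fin d)}
    (hz : z ∈ frontier U) :
    ∃ y, dist z y ≤ r ∧ S ⊆ closedAnnulus y (r - δ) (r + diam U + δ) := by
  obtain ⟨y, hy⟩ := hE z hz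
  have hzy : dist z y ≤ r := (hy.symm.subset rfl).1
  refine ⟨y, hzy, fun w hw ↦ ?_⟩
  obtain ⟨v, hv, hwv⟩ := mem_thickening_iff.1 (hS hw)
  have r_le : r ≤ dist v y := by
    by_contra! h
    obtain rfl : v = z := hy.subset ⟨h.le, subset_closure hv⟩
    exact (hU.frontier_eq.subset hz).2 hv
  have dist_le : dist v z ≤ diam U := by
    rw [← diam_closure]
    exact dist_le_diam_of_mem hb.closure (subset_closure hv) (frontier_subset_closure hz)
  rw [mem_closedAnnulus]
  constructor <;> linarith [dist_triangle_left v y w, dist_triangle w v y, dist_triangle v z y]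

theorem expectedExitTime_le (hE : ExteriorBallCondition U r) (hU : IsOpen U)
    (hb : Bornology.IsBounded U) (hδ : 0 ≤ δ) (hδr : δ < r / 2) (hS : S ⊆ thickening δ U)
    (hα : α ≠ 0) {x : EuclideanSpace ℝ (Fin d)} {W : Measure (PathSpace d)}
    (hW : IsWienerMeasure α x W) (hx : x ∈ cthickening (3 * δ) (frontier U)) :
    expectedExitTime W S ≤ ENNReal.ofReal (exteriorBallConst d r (diam U) / α * δ) := by
  have compact_frontier : IsCompact (frontier U) :=
    isCompact_of_isClosed_isBounded isClosed_frontier (hb.closure.subset frontier_subset_closure)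
  rw [compact_frontier.cthickening_eq_biUnion_closedBall (by positivity)] at hx
  obtain ⟨z, hz, hxz⟩ := mem_iUnion₂.1 hx
  obtain ⟨y, hzy, hSy⟩ := hE.exists_subset_closedAnnulus hU hb hS hz
  have outer_pos : 0 < 2 * r + diam U := by linarith [diam_nonneg (s := U)]
  have dist_le : dist x y - (r - δ) ≤ 4 * δ := by
    linarith [dist_triangle x z y, mem_closedBall.1 hxz]
  have closedAnnulus_subset : closedAnnulus y (r - δ) (r + diam U + δ) ⊆
      closedAnnulus y (r - δ) (2 * r + diam U) :=
    sdiff_subset_sdiff_left (closedBall_subset_closedBall (by linarith))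
  calc expectedExitTime W S
      ≤ expectedExitTime W (closedAnnulus y (r - δ) (2 * r + diam U)) :=
        expectedExitTime_mono W (hSy.trans closedAnnulus_subset)
    _ ≤ ENNReal.ofReal
          (annulusConst d (r - δ) (2 * r + diam U) / α * (dist x y - (r - δ))) :=
        hW.expectedExitTime_closedAnnulus_le hα (by linarith)
    _ ≤ ENNReal.ofReal (annulusConst d (r - δ) (2 * r + diam U) / α * (4 * δ)) := by
        have := annulusConst_pos d (r - δ) outer_pos
        gcongr
    _ ≤ ENNReal.ofReal (annulusConst d (r / 2) (2 * r + diam U) / α * (4 * δ)) := by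
        have := annulusConst_anti d (r := r / 2) (r₁ := r - δ) (by linarith) (by linarith)
          outer_pos.le
        gcongr
    _ = ENNReal.ofReal (exteriorBallConst d r (diam U) / α * δ) := by
        rw [exteriorBallConst]
        ring_nf

theorem exists_iSup_expectedExitTime_smul_lt (hE : ExteriorBallCondition U r) (hU : IsOpen U)
    (hb : Bornology.IsBounded U) (hr : 0 < r) {a : ℝ} (ha : 0 < a) :
    ∃ C : ℝ, 0 < C ∧
      ∀ α ≥ a,
      ∀ W : EuclideanSpace ℝ (Fin d) → Measure (PathSpace d),
        (∀ x, IsWienerMeasure α x (W x)) →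
      ∀ ε : ℝ, 0 < ε → ∀ δ : ℝ, 0 < δ → δ < r / (2 * ε) →
      ∀ S ⊆ thickening δ (ε⁻¹ • U),
        (⨆ x ∈ cthickening (3 * δ) (frontier (ε⁻¹ • U)), expectedExitTime (W x) S) <
          ENNReal.ofReal (C * ε⁻¹ * δ) := by
  have const_nonneg : 0 ≤ exteriorBallConst d r (diam U) :=
    exteriorBallConst_nonneg d hr diam_nonneg
  refine ⟨exteriorBallConst d r (diam U) / a + 1, by positivity,
    fun α hα W hW ε hε δ hδ hδr S hS ↦ ?_⟩
  lift α to ℝ≥0 using ha.le.trans hα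
  have hα' : α ≠ 0 := NNReal.coe_ne_zero.1 (ha.trans_le hα).ne'
  have hε' : 0 < ε⁻¹ := inv_pos.2 hε
  have const_smul : exteriorBallConst d (ε⁻¹ * r) (diam (ε⁻¹ • U)) =
      ε⁻¹ * exteriorBallConst d r (diam U) := by
    rw [diam_smul₀, Real.norm_of_nonneg hε'.le, exteriorBallConst_mul d hε'.ne']
  calc ⨆ x ∈ cthickening (3 * δ) (frontier (ε⁻¹ • U)), expectedExitTime (W x) S
      ≤ ENNReal.ofReal (exteriorBallConst d (ε⁻¹ * r) (diam (ε⁻¹ • U)) / α * δ) :=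
        iSup₂_le fun x hx ↦ (hE.smul hε').expectedExitTime_le (hU.smul₀ hε'.ne') (hb.smul₀ ε⁻¹)
          hδ.le (hδr.trans_eq (by field_simp)) hS hα' (hW x) hx
    _ ≤ ENNReal.ofReal (exteriorBallConst d r (diam U) / a * ε⁻¹ * δ) := by
        rw [const_smul, mul_comm ε⁻¹, mul_div_right_comm]
        gcongr
    _ < ENNReal.ofReal ((exteriorBallConst d r (diam U) / a + 1) * ε⁻¹ * δ) := by
        rw [ENNReal.ofReal_lt_ofReal_iff (by positivity)]
        gcongr
        exact lt_add_one _

theorem exists_iSup_expectedExitTime_smul_le_and_thickening_lt (hE : ExteriorBallCondition U r)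
    (hU : IsOpen U) (hb : Bornology.IsBounded U) (hr : 0 < r) {a : ℝ} (ha : 0 < a) :
    ∃ C : ℝ, 0 < C ∧
      ∀ α ≥ a,
      ∀ W : EuclideanSpace ℝ (Fin d) → Measure (PathSpace d),
        (∀ x, IsWienerMeasure α x (W x)) →
      ∀ ε : ℝ, 0 < ε → ∀ δ : ℝ, 0 < δ → δ < r / (2 * ε) →
        (⨆ x ∈ cthickening δ (frontier (ε⁻¹ • U)), expectedExitTime (W x) (ε⁻¹ • U)) ≤
            ENNReal.ofReal (C * ε⁻¹ * δ) ∧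
        (⨆ x ∈ cthickening (2 * δ) (frontier (thickening δ (ε⁻¹ • U))),
            expectedExitTime (W x) (thickening δ (ε⁻¹ • U))) <
          ENNReal.ofReal (C * ε⁻¹ * δ) := by
  obtain ⟨C, hC, iSup_lt⟩ := hE.exists_iSup_expectedExitTime_smul_lt hU hb hr ha
  refine ⟨C, hC, fun α hα W hW ε hε δ hδ hδr ↦ ?_⟩
  have near_boundary_lt := iSup_lt α hα W hW ε hε δ hδ hδr
  have cthickening_subset : cthickening (2 * δ) (frontier (thickening δ (ε⁻¹ • U))) ⊆
      cthickening (3 * δ) (frontier (ε⁻¹ • U)) :=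
    (cthickening_frontier_thickening_subset hδ.le (by positivity) _).trans_eq
      (congrArg (cthickening · _) (by ring))
  exact ⟨((biSup_mono (cthickening_mono (by linarith) _)).trans_lt
      (near_boundary_lt _ (self_subset_thickening hδ _))).le,
    (biSup_mono cthickening_subset).trans_lt (near_boundary_lt _ subset_rfl)⟩

end ExteriorBallCondition

end ExteriorBall

section ExitTimeEstimates

lemma dist_sub_le_infDist_sphere {E : Type*} [NormedAddCommGroup E] [NormedSpace ℝ E] {c x : E}
    {r : ℝ} (hr : 0 ≤ r) (hx : x ≠ c) : dist x c - r ≤ infDist x (sphere c r) := by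
  have := nontrivial_of_ne x c hx
  refine (le_infDist (NormedSpace.sphere_nonempty.2 hr)).2 fun z hz ↦ ?_
  linarith [dist_triangle x z c, mem_sphere.1 hz]

lemma exists_expectedExitTime_annulus_le (d : ℕ) {a r₁ r₂ : ℝ} (ha : 0 < a) (hr₁ : 0 < r₁)
    (hr₂ : 0 < r₂) :
    ∃ C : ℝ, 0 < C ∧
      ∀ α ≥ a, ∀ x, ∀ W : Measure (PathSpace d), IsWienerMeasure α x W →
        expectedExitTime W (annulus d r₁ r₂) ≤ ENNReal.ofReal (C * infDist x (sphere 0 r₁)) := by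
  have const_pos := annulusConst_pos d r₁ hr₂
  refine ⟨annulusConst d r₁ r₂ / a, by positivity, fun α hα x W hW ↦ ?_⟩
  lift α to ℝ≥0 using ha.le.trans hα
  have hα' : α ≠ 0 := NNReal.coe_ne_zero.1 (ha.trans_le hα).ne'
  by_cases hx : x ∈ annulus d r₁ r₂
  · have r₁_lt : r₁ < dist x 0 := not_le.1 hx.2
    have annulus_subset : annulus d r₁ r₂ ⊆ closedAnnulus 0 r₁ r₂ :=
      sdiff_subset_sdiff ball_subset_closedBall ball_subset_closedBall
    calc expectedExitTime W (annulus d r₁ r₂)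
        ≤ expectedExitTime W (closedAnnulus 0 r₁ r₂) := expectedExitTime_mono W annulus_subset
      _ ≤ ENNReal.ofReal (annulusConst d r₁ r₂ / α * (dist x 0 - r₁)) :=
          hW.expectedExitTime_closedAnnulus_le hα' hr₁
      _ ≤ ENNReal.ofReal (annulusConst d r₁ r₂ / a * infDist x (sphere 0 r₁)) := by
          have := sub_nonneg.2 r₁_lt.le
          gcongr
          exact dist_sub_le_infDist_sphere hr₁.le (dist_pos.1 (hr₁.trans r₁_lt))
  · rw [hW.expectedExitTime_eq_zero (by positivity) hx]
    exact zero_le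

end ExitTimeEstimates

theorem mainTheorem7_general (d : ℕ) {a : ℝ} (ha : 0 < a) :
    (∀ r₁ r₂ : ℝ, 0 < r₁ → r₁ < r₂ →
      ∃ C : ℝ, 0 < C ∧
        ∀ α ≥ a,
        ∀ W : EuclideanSpace ℝ (Fin d) → Measure (PathSpace d),
          (∀ x, IsWienerMeasure α x (W x)) →
        ∀ x,
          expectedExitTime (W x) (annulus d r₁ r₂) ≤
            ENNReal.ofReal (C * infDist x (sphere 0 r₁))) ∧
    ∀ (U : Set (EuclideanSpace ℝ (Fin d))) (r₀ : ℝ),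
      IsOpen U → Bornology.IsBounded U → 0 < r₀ → ExteriorBallCondition U r₀ →
      (∃ C : ℝ, 0 < C ∧
        ∀ α ≥ a,
        ∀ W : EuclideanSpace ℝ (Fin d) → Measure (PathSpace d),
          (∀ x, IsWienerMeasure α x (W x)) →
        ∀ δ : ℝ, 0 < δ → δ < r₀ / 2 →
          (⨆ x ∈ cthickening δ (frontier U), expectedExitTime (W x) U) ≤
              ENNReal.ofReal (C * δ) ∧
          (⨆ x ∈ cthickening (2 * δ) (frontier (thickening δ U)),
              expectedExitTime (W x) (thickening δ U)) <
            ENNReal.ofReal (C * δ)) ∧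
      (∃ C : ℝ, 0 < C ∧
        ∀ α ≥ a,
        ∀ W : EuclideanSpace ℝ (Fin d) → Measure (PathSpace d),
          (∀ x, IsWienerMeasure α x (W x)) →
        ∀ ε : ℝ, 0 < ε → ∀ δ : ℝ, 0 < δ → δ < r₀ / (2 * ε) →
          (⨆ x ∈ cthickening δ (frontier (ε⁻¹ • U)), expectedExitTime (W x) (ε⁻¹ • U)) ≤
              ENNReal.ofReal (C * ε⁻¹ * δ) ∧
          (⨆ x ∈ cthickening (2 * δ) (frontier (thickening δ (ε⁻¹ • U))),
              expectedExitTime (W x) (thickening δ (ε⁻¹ • U))) <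
            ENNReal.ofReal (C * ε⁻¹ * δ)) := by
  refine ⟨fun r₁ r₂ hr₁ hr ↦ ?_, fun U r₀ hU hb hr₀ hE ↦ ?_⟩
  · obtain ⟨C, hC, le⟩ := exists_expectedExitTime_annulus_le d ha hr₁ (hr₁.trans hr)
    exact ⟨C, hC, fun α hα W hW x ↦ le α hα x (W x) (hW x)⟩
  obtain ⟨C, hC, scaled⟩ := hE.exists_iSup_expectedExitTime_smul_le_and_thickening_lt hU hb hr₀ ha
  refine ⟨⟨C, hC, fun α hα W hW δ hδ hδr ↦ ?_⟩, C, hC, scaled⟩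
  simpa using scaled α hα W hW 1 one_pos δ hδ (by simpa)

theorem mainTheorem7 (d : ℕ) (hd : 3 ≤ d) (ν : ℝ) (hν : 1 < ν) :
    -- the annulus estimate
    (∀ r₁ r₂ : ℝ, 0 < r₁ → r₁ < r₂ →
      ∃ C : ℝ, 0 < C ∧
        ∀ α ∈ Icc (1 / (2 * ν)) (2 * ν),
        ∀ W : EuclideanSpace ℝ (Fin d) → Measure (PathSpace d),
          (∀ x, IsWienerMeasure α x (W x)) →
        ∀ x ∈ closure (annulus d r₁ r₂),
          expectedExitTime (W x) (annulus d r₁ r₂) ≤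
            ENNReal.ofReal (C * infDist x (sphere 0 r₁))) ∧
    ∀ (U : Set (EuclideanSpace ℝ (Fin d))) (r₀ : ℝ),
      IsOpen U → Bornology.IsBounded U → 0 < r₀ → ExteriorBallCondition U r₀ →
      -- the estimates for `U` and for its inflation `U_δ`
      (∃ C : ℝ, 0 < C ∧
        ∀ α ∈ Icc (1 / (2 * ν)) (2 * ν),
        ∀ W : EuclideanSpace ℝ (Fin d) → Measure (PathSpace d),
          (∀ x, IsWienerMeasure α x (W x)) →
        ∀ δ : ℝ, 0 < δ → δ < r₀ / 2 →
          (⨆ x ∈ cthickening δ (frontier U), expectedExitTime (W x) U) ≤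
              ENNReal.ofReal (C * δ) ∧
          (⨆ x ∈ cthickening (2 * δ) (frontier (thickening δ U)),
              expectedExitTime (W x) (thickening δ U)) <
            ENNReal.ofReal (C * δ)) ∧
      -- the estimates for `U / ε` and for its `δ`-neighbourhood
      (∃ C : ℝ, 0 < C ∧
        ∀ α ∈ Icc (1 / (2 * ν)) (2 * ν),
        ∀ W : EuclideanSpace ℝ (Fin d) → Measure (PathSpace d),
          (∀ x, IsWienerMeasure α x (W x)) →
        ∀ ε : ℝ, 0 < ε → ∀ δ : ℝ, 0 < δ → δ < r₀ / (2 * ε) →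
          (⨆ x ∈ cthickening δ (frontier (ε⁻¹ • U)), expectedExitTime (W x) (ε⁻¹ • U)) ≤
              ENNReal.ofReal (C * ε⁻¹ * δ) ∧
          (⨆ x ∈ cthickening (2 * δ) (frontier (thickening δ (ε⁻¹ • U))),
              expectedExitTime (W x) (thickening δ (ε⁻¹ • U))) <
            ENNReal.ofReal (C * ε⁻¹ * δ)) := by
  obtain ⟨annulus_le, exteriorBall_le⟩ :=
    mainTheorem7_general d (a := 1 / (2 * ν)) (by positivity)
  refine ⟨fun r₁ r₂ hr₁ hr ↦ ?_, fun U r₀ hU hb hr₀ hE ↦ ?_⟩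
  · obtain ⟨C, hC, le⟩ := annulus_le r₁ r₂ hr₁ hr
    exact ⟨C, hC, fun α hα W hW x _ ↦ le α hα.1 W hW x⟩
  · obtain ⟨⟨C, hC, le⟩, C', hC', scaled_le⟩ := exteriorBall_le U r₀ hU hb hr₀ hE
    exact ⟨⟨C, hC, fun α hα ↦ le α hα.1⟩, C', hC', fun α hα ↦ scaled_le α hα.1⟩
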